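/- Let $(X,R,X^\vee,R^\vee,\Pi)$ be a (reduced) based root datum, with finite Weyl group $W_0=W(R)$ and extended affine Weyl group $\tilde W=X\rtimes W_0$. Write $t^\lambda\in\tilde W$ for the translation by $\lambda\in X$. For $w\in\tilde W$ one has $w^{|W_0|}=t^{\lambda}$ for some $\lambda\in X$, and the Newton point of $w$ is $\nu_w=\lambda/|W_0|\in X_{\mathbb Q}=X\otimes\mathbb Q$. It is called dominant if $\langle\nu_w,\alpha^\vee\rangle\ge 0$ for all $\alpha\in\Pi$. For $J\subset\Pi$ let $W_J\subset W_0$ be the subgroup generated by the reflections $s_\alpha$, $\alpha\in J$, and let $\tilde W_J=X\rtimes W_J\subset\tilde W$. A conjugacy class $C$ of $\tilde W_J$ is called elliptic if $C\cap\tilde W_{K}=\emptyset$ for every proper subset $K\subsetneq J$. Let $\mathcal A$ be the set of all pairs $(J,C)$, where $J\subset\Pi$ and $C$ is an elliptic conjugacy class of $\tilde W_J$ such that $\nu_w$ is dominant for all $w\in C$. Write $(J,C)\sim(J',C')$ if there is $x\in W_0$ with $x(J)=J'$ and $xCx^{-1}=C'$; this is an equivalence relation on $\mathcal A$. Then the map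 $\pi$ that sends $(J,C)$ to the conjugacy class of $\tilde W$ containing $C$ is constant on equivalence classes and induces a bijection $$\pi:\ \mathcal A/\!\sim\ \xrightarrow{\ 1-1\ }\ \{\text{conjugacy classes of }\tilde W\}.$$ -/

import Mathlib

open scoped TensorProduct

noncomputable section

namespace ExtAffineWeyl

/-- The action of the finite Weyl group `W₀` on the lattice `X` that contains the roots, with `X`
written multiplicatively. -/
def weylAction {ι X Y : Type*} [AddCommGroup X] [AddCommGroup Y] (P : RootDatum ι X Y) :
    P.weylGroup →* MulAut (Multiplicative X) :=
  (MulAutMultiplicative X).symm.toMonoidHom.comp (DistribMulAction.toAddAut P.weylGroup X)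

theorem weylAction_apply {ι X Y : Type*} [AddCommGroup X] [AddCommGroup Y] (P : RootDatum ι X Y)
    (x : P.weylGroup) (l : X) :
    weylAction P x (Multiplicative.ofAdd l) = Multiplicative.ofAdd (x • l) := rfl

/-- The extended affine Weyl group `X ⋊ W₀` of a root datum. -/
abbrev ExtWeyl {ι X Y : Type*} [AddCommGroup X] [AddCommGroup Y] (P : RootDatum ι X Y) : Type _ :=
  Multiplicative X ⋊[weylAction P] P.weylGroup

section

variable {ι X Y : Type*} [AddCommGroup X] [AddCommGroup Y] {P : RootDatum ι X Y}

/-- The translation `t^l` in the extended affine Weyl group. -/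
def translation (P : RootDatum ι X Y) (l : X) : ExtWeyl P :=
  SemidirectProduct.inl (Multiplicative.ofAdd l)

/-- The `l` in `X` with `w ^ |W₀| = t^l`. -/
def powTranslation (w : ExtWeyl P) : X :=
  Multiplicative.toAdd (w ^ Nat.card P.weylGroup).left

theorem pow_card_eq_translation (w : ExtWeyl P) :
    w ^ Nat.card P.weylGroup = translation P (powTranslation w) := by
  apply SemidirectProduct.ext
  · simp [translation, powTranslation]
  · have h : SemidirectProduct.rightHom (w ^ Nat.card P.weylGroup) = 1 := by
      rw [map_pow]; exact pow_card_eq_one'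
    simpa [translation] using h

/-- The Newton point `l / |W₀|` in `X_ℚ = ℚ ⊗ X`, where `w ^ |W₀| = t^l`. -/
def newtonPoint (w : ExtWeyl P) : ℚ ⊗[ℤ] X :=
  ((Nat.card P.weylGroup : ℚ)⁻¹) ⊗ₜ[ℤ] powTranslation w

/-- The rational pairing of a vector of `X_ℚ` with the coroot of index `i`. -/
def corootPairing (P : RootDatum ι X Y) (i : ι) (v : ℚ ⊗[ℤ] X) : ℚ :=
  TensorProduct.rid ℤ ℚ ((P.coroot' i).lTensor ℚ v)

theorem corootPairing_tmul (i : ι) (q : ℚ) (l : X) :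
    corootPairing P i (q ⊗ₜ[ℤ] l) = (P.toLinearMap l (P.coroot i) : ℚ) * q := by
  simp [corootPairing, RootPairing.coroot']

/-- Dominance with respect to the simple roots. -/
def IsDominant (b : P.Base) (v : ℚ ⊗[ℤ] X) : Prop :=
  ∀ i ∈ b.support, 0 ≤ corootPairing P i v

/-- The subgroup `W_J` of `W₀` generated by the reflections in the roots indexed by `J`. -/
def finiteParabolic (P : RootDatum ι X Y) (J : Set ι) : Subgroup P.weylGroup :=
  Subgroup.closure (RootPairing.weylGroup.ofIdx P '' J)

/-- The subgroup `X ⋊ W_J` of the extended affine Weyl group `X ⋊ W₀`. -/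
def parabolic (P : RootDatum ι X Y) (J : Set ι) : Subgroup (ExtWeyl P) :=
  (finiteParabolic P J).comap SemidirectProduct.rightHom

/-- A conjugacy class of `X ⋊ W_J`, as a subset of `X ⋊ W₀`. -/
def classSet {J : Set ι} (C : ConjClasses (parabolic P J)) : Set (ExtWeyl P) :=
  Subtype.val '' C.carrier

/-- A conjugacy class of `X ⋊ W_J` is elliptic if it meets no `X ⋊ W_K` with `K` a proper subset
of `J`. -/
def IsElliptic {J : Set ι} (C : ConjClasses (parabolic P J)) : Prop :=
  ∀ K : Set ι, K ⊂ J → Disjoint (classSet C) (parabolic P K : Set (ExtWeyl P))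

/-- The pairs `(J, C)`, with `J` a set of simple roots and `C` an elliptic conjugacy class of
`X ⋊ W_J` all of whose elements have dominant Newton point. -/
structure EllipticPair (b : P.Base) where
  J : Set ι
  subset_simple : J ⊆ b.support
  C : ConjClasses (parabolic P J)
  elliptic : IsElliptic C
  dominant : ∀ w ∈ classSet C, IsDominant b (newtonPoint w)

/-- `(J, C) ∼ (J', C')` if some `x` in `W₀` satisfies `x(J) = J'` (as sets of simple roots) and
`x C x⁻¹ = C'`. -/
def EllipticPair.Rel {b : P.Base} (p q : EllipticPair b) : Prop :=
  ∃ x : P.weylGroup, (fun v : X => x • v) '' (P.root '' p.J) = P.root '' q.J ∧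
    (fun w : ExtWeyl P => SemidirectProduct.inr x * w * (SemidirectProduct.inr x)⁻¹) ''
      classSet p.C = classSet q.C

theorem EllipticPair.rel_equivalence (b : P.Base) :
    Equivalence (EllipticPair.Rel (b := b)) where
  refl p := ⟨1, by simp, by simp⟩
  symm := by
    rintro p q ⟨x, h1, h2⟩
    refine ⟨x⁻¹, ?_, ?_⟩
    · rw [← h1, Set.image_image]; simp
    · rw [← h2, Set.image_image]; simp [mul_assoc]
  trans := by
    rintro p q r ⟨x, h1, h2⟩ ⟨y, h3, h4⟩
    refine ⟨y * x, ?_, ?_⟩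
    · rw [← h3, ← h1]; simp only [Set.image_image, mul_smul]
    · rw [← h4, ← h2]; simp only [Set.image_image, map_mul, mul_inv_rev, mul_assoc]

instance EllipticPair.setoid (b : P.Base) : Setoid (EllipticPair b) :=
  ⟨EllipticPair.Rel, EllipticPair.rel_equivalence b⟩

/-- The conjugacy class of `X ⋊ W₀` that contains `C`. -/
def EllipticPair.toConjClass {b : P.Base} (p : EllipticPair b) : ConjClasses (ExtWeyl P) :=
  ConjClasses.map (parabolic P p.J).subtype p.C

theorem EllipticPair.toConjClass_eq {b : P.Base} (p : EllipticPair b) {w : ExtWeyl P}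
    (hw : w ∈ classSet p.C) : p.toConjClass = ConjClasses.mk w := by
  obtain ⟨v, hv, rfl⟩ := hw
  rw [ConjClasses.mem_carrier_iff_mk_eq] at hv
  rw [EllipticPair.toConjClass, ← hv]
  rfl

theorem EllipticPair.toConjClass_eq_of_rel {b : P.Base} (p q : EllipticPair b)
    (h : EllipticPair.Rel p q) : p.toConjClass = q.toConjClass := by
  obtain ⟨x, -, h2⟩ := h
  obtain ⟨v, hv⟩ := ConjClasses.exists_rep p.C
  have hp : (v : ExtWeyl P) ∈ classSet p.C :=
    ⟨v, ConjClasses.mem_carrier_iff_mk_eq.2 hv, rfl⟩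
  have hq : SemidirectProduct.inr x * (v : ExtWeyl P) * (SemidirectProduct.inr x)⁻¹ ∈
      classSet q.C := by
    rw [← h2]; exact ⟨_, hp, rfl⟩
  rw [p.toConjClass_eq hp, q.toConjClass_eq hq, ConjClasses.mk_eq_mk_iff_isConj]
  exact isConj_iff.2 ⟨SemidirectProduct.inr x, rfl⟩

/-- The map `π` from equivalence classes of pairs to conjugacy classes of `X ⋊ W₀`, sending the
class of `(J, C)` to the conjugacy class that contains `C`. -/
def pairClassMap (b : P.Base) :
    Quotient (EllipticPair.setoid b) → ConjClasses (ExtWeyl P) :=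
  Quotient.lift EllipticPair.toConjClass EllipticPair.toConjClass_eq_of_rel

end

end ExtAffineWeyl

end

/-! ### Equivariance of the pairing, face vectors and positive coroots -/

namespace ExtAffineWeyl

open RootPairing

section

variable {ι X Y : Type*} [AddCommGroup X] [AddCommGroup Y] {P : RootDatum ι X Y}

/-! Since `X ⋊ W_K` is the full preimage of `W_K`, ellipticity is a property of finite parts, and
conjugating `w` moves `powTranslation w` by a finite Weyl element.

Surjectivity: conjugate `w` until λ = `powTranslation w` is dominant. The finite part of `w` fixes
λ, so by `smul_eq_of_dominant` it lies in `W_{J₀}`, with `J₀` the simple roots whose coroots kill λ.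
Take `J ⊆ J₀` minimal such that `W_J` contains a `W_{J₀}`-conjugate of this finite part. Minimality
gives ellipticity, and dominance persists because `W_{J₀}` fixes λ.

Injectivity: a vector fixed by an elliptic `x` of `W_J` is killed by the coroots of `J`
(`IsEllipticIn.coroot'_eq_zero`). If `y x y⁻¹` is elliptic in `W_K`, applying this to both elements
shows that `y` matches the subsystems of `J` and `K`. A correction `u ∈ W_K` also matches their
positive systems, so `u y` carries `J` onto `K` (`exists_smul_index_image_eq`), and conjugation by
`u` does not change a class of `X ⋊ W_K`.

Chambers are handled inside the lattice: integral face vectors detect signs and supports of coroots.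
-/

theorem ofIdx_smul_eq (i : ι) (v : X) :
    weylGroup.ofIdx P i • v = v - P.coroot' i v • P.root i := rfl

theorem root_smul (g : P.weylGroup) (i : ι) : P.root (g • i) = g • P.root i :=
  Equiv.root_indexEquiv_eq_smul P i g.1

theorem coroot'_smul_smul (g : P.weylGroup) (i : ι) (v : X) :
    P.coroot' (g • i) (g • v) = P.coroot' i v := by
  have h1 := Hom.weight_coweight_transpose_apply P P (P.coroot (g • i)) g.1.toHom
  have h2 : g.1.toHom.coweightMap (P.coroot (g • i)) = P.coroot i := by
    rw [Hom.coroot_coweightMap_apply]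
    exact congrArg P.coroot (g.1.toHom.indexEquiv.symm_apply_apply i)
  rw [h2] at h1
  exact LinearMap.congr_fun h1 v

theorem coroot'_smul (g : P.weylGroup) (i : ι) (v : X) :
    P.coroot' (g • i) v = P.coroot' i (g⁻¹ • v) := by
  rw [← coroot'_smul_smul g i (g⁻¹ • v), smul_inv_smul]

theorem weylGroup_ext {g h : P.weylGroup} (H : ∀ v : X, g • v = h • v) : g = h :=
  Subtype.ext (Equiv.weightHom_injective P (LinearEquiv.ext H))

theorem ofIdx_mul_self (i : ι) : weylGroup.ofIdx P i * weylGroup.ofIdx P i = 1 := by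
  apply weylGroup_ext
  intro v
  rw [mul_smul, one_smul]
  exact P.reflection_same i v

theorem ofIdx_smul_index (g : P.weylGroup) (i : ι) :
    weylGroup.ofIdx P (g • i) = g * weylGroup.ofIdx P i * g⁻¹ := by
  apply weylGroup_ext
  intro v
  rw [mul_smul, mul_smul, ofIdx_smul_eq, ofIdx_smul_eq, smul_sub, smul_inv_smul, coroot'_smul,
    root_smul]
  congr 1
  exact (map_zsmul (DistribSMul.toAddMonoidHom X g) _ _).symm

theorem coroot'_self (i : ι) : P.coroot' i (P.root i) = 2 := P.root_coroot_two i

theorem coroot'_apply_eq_zero_of_mem_closure {K : Set ι} {v : X}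
    (hv : ∀ i ∈ K, P.coroot' i v = 0) {m : Y}
    (hm : m ∈ AddSubmonoid.closure (P.coroot '' K)) : P.toLinearMap v m = 0 := by
  induction hm using AddSubmonoid.closure_induction with
  | mem x hx => obtain ⟨i, hi, rfl⟩ := hx; exact hv i hi
  | zero => simp
  | add x y _ _ hx hy => simp [hx, hy]

theorem toLinearMap_nonneg_of_mem_closure {K : Set ι} {v : X}
    (hv : ∀ i ∈ K, 0 ≤ P.coroot' i v) {m : Y}
    (hm : m ∈ AddSubmonoid.closure (P.coroot '' K)) : 0 ≤ P.toLinearMap v m := by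
  induction hm using AddSubmonoid.closure_induction with
  | mem x hx => obtain ⟨i, hi, rfl⟩ := hx; exact hv i hi
  | zero => simp
  | add x y _ _ hx hy => rw [map_add]; exact add_nonneg hx hy

theorem toLinearMap_pos_of_mem_closure {K : Set ι} {v : X}
    (hv : ∀ i ∈ K, 0 < P.coroot' i v) {m : Y}
    (hm : m ∈ AddSubmonoid.closure (P.coroot '' K)) (h0 : m ≠ 0) : 0 < P.toLinearMap v m := by
  have h : m = 0 ∨ 0 < P.toLinearMap v m := by
    clear h0
    induction hm using AddSubmonoid.closure_induction with
    | mem x hx => obtain ⟨i, hi, rfl⟩ := hx; exact Or.inr (hv i hi)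
    | zero => simp
    | add x y _ _ hx hy =>
      rcases hx with rfl | hx
      · simpa using hy
      rcases hy with rfl | hy
      · simpa using Or.inr hx
      · rw [map_add]; exact Or.inr (add_pos hx hy)
  exact h.resolve_left h0

variable [Finite ι] (b : P.Base)

theorem eq_zero_of_coroot'_eq_zero {x : X} (hx : x ∈ P.rootSpan ℤ)
    (h : ∀ i ∈ b.support, P.coroot' i x = 0) : x = 0 := by
  have := Fintype.ofFinite ι
  have h' (i : ι) : P.coroot' i x = 0 := by
    rcases b.coroot_mem_or_neg_mem i with hi | hi
    · exact coroot'_apply_eq_zero_of_mem_closure h hi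
    · have := coroot'_apply_eq_zero_of_mem_closure h hi
      rw [map_neg, neg_eq_zero] at this
      exact this
  refine Submodule.disjoint_def.1 P.disjoint_rootSpan_ker_rootForm x hx ?_
  rw [LinearMap.mem_ker]
  ext y
  simp only [RootPairing.rootForm_apply_apply, LinearMap.zero_apply]
  exact Finset.sum_eq_zero fun i _ => by
    rw [h' i, zero_mul]

/-- The Cartan matrix `A` is nonsingular, so its adjugate solves the system over ℤ up to the factor
`det A`. Prescribing `det A` off `J` makes the pairings there `(det A)²`, hence positive. -/
theorem exists_faceVector (J : Set ι) : ∃ v : X, (∀ i ∈ b.support, i ∈ J → P.coroot' i v = 0) ∧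
    ∀ i ∈ b.support, i ∉ J → 0 < P.coroot' i v := by
  classical
  let A : Matrix b.support b.support ℤ := fun j k => P.coroot' k (P.root j)
  have key (c : b.support → ℤ) (k : b.support) :
      P.coroot' k (∑ j, c j • P.root j) = (Matrix.vecMul c A) k := by
    simp [Matrix.vecMul, dotProduct, A]
  have hA : A.det ≠ 0 := by
    intro h0
    obtain ⟨c, hc, hcA⟩ := Matrix.exists_vecMul_eq_zero_iff.2 h0
    apply hc
    have hx : ∑ j, c j • P.root j = 0 := by
      apply eq_zero_of_coroot'_eq_zero b
      · exact Submodule.sum_mem _ fun j _ =>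
          Submodule.smul_mem _ _ (Submodule.subset_span ⟨j, rfl⟩)
      · intro i hi
        have := key c ⟨i, hi⟩
        rw [hcA] at this
        simpa using this
    have hli : LinearIndependent ℤ fun j : b.support => P.root j := b.linearIndepOn_root
    exact funext (Fintype.linearIndependent_iff.1 hli c hx)
  let e : b.support → ℤ := fun k => if (k : ι) ∈ J then 0 else A.det
  have hv (k : b.support) :
      P.coroot' k (∑ j, (Matrix.vecMul e A.adjugate) j • P.root j) = A.det * e k := by
    rw [key, Matrix.vecMul_vecMul, Matrix.adjugate_mul, Matrix.vecMul_smul, Matrix.vecMul_one]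
    rfl
  refine ⟨∑ j, (Matrix.vecMul e A.adjugate) j • P.root j, fun i hi hJ => ?_, fun i hi hJ => ?_⟩
  · rw [hv ⟨i, hi⟩]; simp [e, hJ]
  · rw [hv ⟨i, hi⟩]
    simpa [e, hJ] using hA

/-- A vector of `X` lying in the relative interior of the face of the dominant chamber that is
cut out by the simple coroots with index in `J`. -/
noncomputable def faceVector (J : Set ι) : X := (exists_faceVector b J).choose

theorem coroot'_faceVector_eq_zero {J : Set ι} {i : ι} (hi : i ∈ b.support) (hJ : i ∈ J) :
    P.coroot' i (faceVector b J) = 0 :=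
  (exists_faceVector b J).choose_spec.1 i hi hJ

theorem coroot'_faceVector_pos {J : Set ι} {i : ι} (hi : i ∈ b.support) (hJ : i ∉ J) :
    0 < P.coroot' i (faceVector b J) :=
  (exists_faceVector b J).choose_spec.2 i hi hJ

theorem coroot'_faceVector_nonneg (J : Set ι) {i : ι} (hi : i ∈ b.support) :
    0 ≤ P.coroot' i (faceVector b J) := by
  by_cases hJ : i ∈ J
  · rw [coroot'_faceVector_eq_zero b hi hJ]
  · exact (coroot'_faceVector_pos b hi hJ).le

/-- The coroot with index `i` is a nonnegative combination of simple coroots. -/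
def IsPosCoroot (i : ι) : Prop := P.coroot i ∈ AddSubmonoid.closure (P.coroot '' b.support)

variable {b}

omit [Finite ι] in
theorem isPosCoroot_of_mem_support {i : ι} (hi : i ∈ b.support) : IsPosCoroot b i :=
  AddSubmonoid.subset_closure ⟨i, hi, rfl⟩

omit [Finite ι] in
theorem IsPosCoroot.nonneg {i : ι} (hi : IsPosCoroot b i) {v : X}
    (hv : ∀ j ∈ b.support, 0 ≤ P.coroot' j v) : 0 ≤ P.coroot' i v :=
  toLinearMap_nonneg_of_mem_closure hv hi

omit [Finite ι] in
theorem nonpos_of_not_isPosCoroot {i : ι} (hi : ¬ IsPosCoroot b i) {v : X}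
    (hv : ∀ j ∈ b.support, 0 ≤ P.coroot' j v) : P.coroot' i v ≤ 0 := by
  have h := toLinearMap_nonneg_of_mem_closure hv ((b.coroot_mem_or_neg_mem i).resolve_left hi)
  rw [map_neg] at h
  exact neg_nonneg.1 h

omit [Finite ι] in
theorem IsPosCoroot.of_pos {i : ι} {v : X} (hv : ∀ j ∈ b.support, 0 ≤ P.coroot' j v)
    (hi : 0 < P.coroot' i v) : IsPosCoroot b i := by
  by_contra h
  exact (nonpos_of_not_isPosCoroot h hv).not_gt hi

theorem IsPosCoroot.of_faceVector_nonneg {i : ι}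
    (hi : 0 ≤ P.coroot' i (faceVector b ∅)) : IsPosCoroot b i := by
  by_contra h
  have h' := toLinearMap_pos_of_mem_closure
    (fun j hj => coroot'_faceVector_pos b hj (Set.notMem_empty j))
    ((b.coroot_mem_or_neg_mem i).resolve_left h) (neg_ne_zero.2 (P.ne_zero' i))
  rw [map_neg] at h'
  exact (neg_pos.1 h').not_ge hi

theorem mem_closure_of_faceVector_eq_zero {J : Set ι} {m : Y}
    (hm : m ∈ AddSubmonoid.closure (P.coroot '' b.support))
    (h0 : P.toLinearMap (faceVector b J) m = 0) : m ∈ AddSubmonoid.closure (P.coroot '' J) := by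
  have hnn := fun i (hi : i ∈ (b.support : Set ι)) => coroot'_faceVector_nonneg b J hi
  induction hm using AddSubmonoid.closure_induction with
  | mem x hx =>
    obtain ⟨i, hi, rfl⟩ := hx
    by_cases hiJ : i ∈ J
    · exact AddSubmonoid.subset_closure ⟨i, hiJ, rfl⟩
    · exact absurd h0 (coroot'_faceVector_pos b hi hiJ).ne'
  | zero => exact zero_mem _
  | add x y hx hy ihx ihy =>
    rw [map_add] at h0
    have h1 := toLinearMap_nonneg_of_mem_closure hnn hx
    have h2 := toLinearMap_nonneg_of_mem_closure hnn hy
    exact add_mem (ihx (by omega)) (ihy (by omega))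

/-- If the pairing vanished, the coroot would be a natural multiple of the simple coroot `j`, and
only the multiple 1 is a positive coroot. This is why a simple reflection permutes the other
positive coroots. -/
theorem IsPosCoroot.faceVector_singleton_pos {i j : ι} (hi : IsPosCoroot b i) (hj : j ∈ b.support)
    (hij : i ≠ j) : 0 < P.coroot' i (faceVector b {j}) := by
  refine lt_of_le_of_ne (hi.nonneg fun k hk => coroot'_faceVector_nonneg b _ hk) fun h0 => hij ?_
  have hm := mem_closure_of_faceVector_eq_zero hi h0.symm
  rw [Set.image_singleton, AddSubmonoid.mem_closure_singleton] at hm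
  obtain ⟨n, hn⟩ := hm
  have hX : IsAddTorsionFree X := by
    have : Module.IsReflexive ℤ X := .of_isPerfPair P.toLinearMap
    exact Module.isTorsionFree_int_iff_isAddTorsionFree.1 inferInstance
  have hY : IsAddTorsionFree Y := by
    have : Module.IsReflexive ℤ Y := .of_isPerfPair P.flip.toLinearMap
    exact Module.isTorsionFree_int_iff_isAddTorsionFree.1 inferInstance
  rcases b.flip.eq_one_or_neg_one_of_mem_support_of_smul_mem j hj n
    ⟨i, by rw [natCast_zsmul]; exact hn.symm⟩ with h | h
  · have : n = 1 := by omega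
    rw [this, one_smul] at hn
    exact P.coroot.injective hn.symm
  · omega

theorem IsPosCoroot.ofIdx_smul {i j : ι} (hi : IsPosCoroot b i) (hj : j ∈ b.support)
    (hij : i ≠ j) : IsPosCoroot b (weylGroup.ofIdx P j • i) := by
  refine IsPosCoroot.of_pos (v := faceVector b {j})
    (fun k hk => coroot'_faceVector_nonneg b _ hk) ?_
  have h : weylGroup.ofIdx P j • faceVector b {j} = faceVector b {j} := by
    rw [ofIdx_smul_eq, coroot'_faceVector_eq_zero b hj (Set.mem_singleton j), zero_smul, sub_zero]
  rw [← h, coroot'_smul_smul]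
  exact hi.faceVector_singleton_pos hj hij

end

end ExtAffineWeyl

/-! ### Exchange, stabilizers of dominant vectors and finiteness of the Weyl group -/

namespace ExtAffineWeyl

open RootPairing

section

variable {ι X Y : Type*} [AddCommGroup X] [AddCommGroup Y] {P : RootDatum ι X Y}

theorem ofIdx_inv (i : ι) : (weylGroup.ofIdx P i)⁻¹ = weylGroup.ofIdx P i :=
  inv_eq_of_mul_eq_one_left (ofIdx_mul_self i)

theorem ofIdx_mem_finiteParabolic {J : Set ι} {i : ι} (hi : i ∈ J) :
    weylGroup.ofIdx P i ∈ finiteParabolic P J :=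
  Subgroup.subset_closure ⟨i, hi, rfl⟩

theorem finiteParabolic_mono {J K : Set ι} (h : J ⊆ K) :
    finiteParabolic P J ≤ finiteParabolic P K :=
  Subgroup.closure_mono (Set.image_mono h)

theorem smul_eq_of_mem_finiteParabolic {J : Set ι} {v : X} (hv : ∀ j ∈ J, P.coroot' j v = 0)
    {g : P.weylGroup} (hg : g ∈ finiteParabolic P J) : g • v = v := by
  have h : finiteParabolic P J ≤ MulAction.stabilizer P.weylGroup v := by
    rw [finiteParabolic, Subgroup.closure_le]
    rintro _ ⟨j, hj, rfl⟩
    change weylGroup.ofIdx P j • v = v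
    rw [ofIdx_smul_eq, hv j hj, zero_smul, sub_zero]
  exact h hg

/-- The product of the reflections in a list of indices. -/
noncomputable def reflectionProd (P : RootDatum ι X Y) (l : List ι) : P.weylGroup :=
  (l.map (weylGroup.ofIdx P)).prod

theorem reflectionProd_cons (i : ι) (l : List ι) :
    reflectionProd P (i :: l) = weylGroup.ofIdx P i * reflectionProd P l := by
  simp [reflectionProd]

theorem reflectionProd_append (l m : List ι) :
    reflectionProd P (l ++ m) = reflectionProd P l * reflectionProd P m := by
  simp [reflectionProd]

theorem exists_reflectionProd_eq {J : Set ι} {g : P.weylGroup} (hg : g ∈ finiteParabolic P J) :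
    ∃ l : List ι, (∀ i ∈ l, i ∈ J) ∧ reflectionProd P l = g := by
  rw [finiteParabolic] at hg
  induction hg using Subgroup.closure_induction with
  | mem x hx =>
    obtain ⟨i, hi, rfl⟩ := hx
    exact ⟨[i], by simpa using hi, by simp [reflectionProd]⟩
  | one => exact ⟨[], by simp, rfl⟩
  | mul x y _ _ hx hy =>
    obtain ⟨l, hl, rfl⟩ := hx
    obtain ⟨m, hm, rfl⟩ := hy
    refine ⟨l ++ m, fun i hi => ?_, reflectionProd_append l m⟩
    exact (List.mem_append.1 hi).elim (hl i) (hm i)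
  | inv x _ hx =>
    obtain ⟨l, hl, rfl⟩ := hx
    refine ⟨l.reverse, fun i hi => hl i (List.mem_reverse.1 hi), ?_⟩
    rw [reflectionProd, reflectionProd, List.prod_inv_reverse, List.map_map, List.map_reverse]
    congr 2
    exact List.map_congr_left fun i _ => (ofIdx_inv i).symm

variable [Finite ι] {b : P.Base}

theorem exchange {k : ι} (hk : k ∈ b.support) (l : List ι) (hl : ∀ i ∈ l, i ∈ b.support)
    (h : ¬ IsPosCoroot b (reflectionProd P l • k)) :
    ∃ m : List ι, (∀ i ∈ m, i ∈ b.support) ∧ m.length < l.length ∧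
      reflectionProd P m = reflectionProd P l * weylGroup.ofIdx P k := by
  induction l with
  | nil => exact absurd (by simpa [reflectionProd] using isPosCoroot_of_mem_support hk) h
  | cons a l ih =>
    have hl' : ∀ i ∈ l, i ∈ b.support := fun i hi => hl i (List.mem_cons_of_mem a hi)
    rw [reflectionProd_cons] at h ⊢
    by_cases hpos : IsPosCoroot b (reflectionProd P l • k)
    -- The sign changes exactly at the letter `a`, so the tail sends `k` to `a`; appending `k` to
    -- the word then cancels `a`.
    · have hka : reflectionProd P l • k = a := by
        by_contra hne
        refine h ?_
        rw [mul_smul]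
        exact hpos.ofIdx_smul (hl a List.mem_cons_self) hne
      refine ⟨l, hl', by simp, ?_⟩
      rw [← hka, ofIdx_smul_index, inv_mul_cancel_right, mul_assoc, ofIdx_mul_self, mul_one]
    · obtain ⟨m, hm, hlen, heq⟩ := ih hl' hpos
      refine ⟨a :: m, ?_, by simpa using hlen, by rw [reflectionProd_cons, heq, mul_assoc]⟩
      intro i hi
      rcases List.mem_cons.1 hi with rfl | hi
      · exact hl _ List.mem_cons_self
      · exact hm i hi

/-- Induction on word length. Write `g = g' s_j`. If `g'` makes coroot `j` negative, exchange
shortens the word. Otherwise `g` makes it negative, so dominance of both `v` and `g v` forces `⟨v,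
α_j^∨⟩ = 0`; then `s_j` fixes `v` and can be dropped. -/
theorem reflectionProd_smul_eq_of_dominant (n : ℕ) (l : List ι) (hn : l.length = n)
    (hl : ∀ i ∈ l, i ∈ b.support)
    {v : X} (hv : ∀ i ∈ b.support, 0 ≤ P.coroot' i v)
    (hgv : ∀ i ∈ b.support, 0 ≤ P.coroot' i (reflectionProd P l • v)) :
    reflectionProd P l • v = v ∧
      reflectionProd P l ∈ finiteParabolic P {i | i ∈ b.support ∧ P.coroot' i v = 0} := by
  induction n using Nat.strong_induction_on generalizing l with
  | _ n ih =>
    subst hn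
    rcases l.eq_nil_or_concat with rfl | ⟨l, j, rfl⟩
    · exact ⟨one_smul _ v, one_mem _⟩
    have hj : j ∈ b.support := hl j (by simp)
    have hl' : ∀ i ∈ l, i ∈ b.support := fun i hi => hl i (by simp [hi])
    have hprod : reflectionProd P (l.concat j) = reflectionProd P l * weylGroup.ofIdx P j := by
      rw [List.concat_eq_append, reflectionProd_append]
      simp [reflectionProd]
    rw [hprod] at hgv ⊢
    by_cases hpos : IsPosCoroot b (reflectionProd P l • j)
    · have h1 : ¬ IsPosCoroot b ((reflectionProd P l * weylGroup.ofIdx P j) • j) := by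
        intro h
        have h2 : 0 ≤ P.coroot' (weylGroup.ofIdx P j • j)
            ((reflectionProd P l)⁻¹ • faceVector b ∅) := by
          rw [← coroot'_smul, ← mul_smul]
          exact h.nonneg fun k hk => coroot'_faceVector_nonneg b _ hk
        have h3 : 0 < P.coroot' j ((reflectionProd P l)⁻¹ • faceVector b ∅) := by
          rw [← coroot'_smul]
          refine lt_of_le_of_ne (hpos.nonneg fun k hk => coroot'_faceVector_nonneg b _ hk)
            (toLinearMap_pos_of_mem_closure
              (fun i hi => coroot'_faceVector_pos b hi (Set.notMem_empty i)) hpos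
              (P.ne_zero' _)).ne
        rw [coroot'_smul, ofIdx_inv, ofIdx_smul_eq, map_sub, map_zsmul, coroot'_self,
          smul_eq_mul] at h2
        omega
      have hle : P.coroot' j v ≤ 0 := by
        rw [← coroot'_smul_smul (reflectionProd P l * weylGroup.ofIdx P j) j v]
        exact nonpos_of_not_isPosCoroot h1 hgv
      have h0 : P.coroot' j v = 0 := le_antisymm hle (hv j hj)
      have hfix : weylGroup.ofIdx P j • v = v := by
        rw [ofIdx_smul_eq, h0, zero_smul, sub_zero]
      rw [mul_smul, hfix] at hgv ⊢
      obtain ⟨h3, h4⟩ := ih l.length (by simp) l rfl hl' hgv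
      exact ⟨h3, mul_mem h4 (ofIdx_mem_finiteParabolic ⟨hj, h0⟩)⟩
    · obtain ⟨m, hm, hlen, heq⟩ := exchange hj l hl' hpos
      rw [← heq] at hgv ⊢
      exact ih m.length (by rw [List.length_concat]; omega) m rfl hm hgv

/-- Descent on height, measured by the regular vector `faceVector b ∅`: a non-simple positive coroot
is lowered by some simple reflection and stays positive. -/
theorem ofIdx_mem_of_isPosCoroot (n : ℕ) {i : ι} (hi : IsPosCoroot b i)
    (hn : (P.coroot' i (faceVector b ∅)).toNat = n) :
    weylGroup.ofIdx P i ∈ finiteParabolic P (b.support : Set ι) := by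
  induction n using Nat.strong_induction_on generalizing i with
  | _ n ih =>
    obtain ⟨j, hj, hij⟩ : ∃ j ∈ b.support, 0 < P.coroot' j (P.root i) := by
      -- Otherwise `-P.root i` would be dominant, yet its pairing with the positive coroot `i` is
      -- -2.
      by_contra! h
      have := hi.nonneg (v := -P.root i) fun j hj => by
        rw [map_neg]; exact neg_nonneg.2 (h j hj)
      rw [map_neg, coroot'_self] at this
      omega
    by_cases hne : i = j
    · rw [hne]; exact ofIdx_mem_finiteParabolic hj
    have hji : 0 < P.coroot' i (P.root j) := by
      have h := P.zero_lt_pairingIn_iff' ℤ (i := i) (j := j)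
      have h1 : P.pairingIn ℤ i j = P.coroot' j (P.root i) := P.algebraMap_pairingIn ℤ i j
      have h2 : P.pairingIn ℤ j i = P.coroot' i (P.root j) := P.algebraMap_pairingIn ℤ j i
      rw [h1, h2] at h
      exact h.1 hij
    have hk := hi.ofIdx_smul hj hne
    have hlt : P.coroot' (weylGroup.ofIdx P j • i) (faceVector b ∅) <
        P.coroot' i (faceVector b ∅) := by
      rw [coroot'_smul, ofIdx_inv, ofIdx_smul_eq, map_sub, map_zsmul, smul_eq_mul]
      have := mul_pos (coroot'_faceVector_pos b hj (Set.notMem_empty j)) hji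
      omega
    have h0 := hk.nonneg fun k hk => coroot'_faceVector_nonneg b ∅ hk
    have hmem := ih _ (by omega) hk rfl
    rw [ofIdx_smul_index] at hmem
    have hs : weylGroup.ofIdx P j ∈ finiteParabolic P (b.support : Set ι) :=
      ofIdx_mem_finiteParabolic hj
    rwa [Subgroup.mul_mem_cancel_right _ (inv_mem hs), Subgroup.mul_mem_cancel_left _ hs] at hmem

theorem finiteParabolic_support : finiteParabolic P (b.support : Set ι) = ⊤ := by
  have key (i : ι) : weylGroup.ofIdx P i ∈ finiteParabolic P (b.support : Set ι) := by
    by_cases hi : IsPosCoroot b i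
    · exact ofIdx_mem_of_isPosCoroot _ hi rfl
    · have h : IsPosCoroot b (weylGroup.ofIdx P i • i) := by
        apply IsPosCoroot.of_faceVector_nonneg
        have := nonpos_of_not_isPosCoroot hi fun k hk => coroot'_faceVector_nonneg b ∅ hk
        rw [coroot'_smul, ofIdx_inv, ofIdx_smul_eq, map_sub, map_zsmul, coroot'_self, smul_eq_mul]
        omega
      have h2 := ofIdx_mem_of_isPosCoroot _ h rfl
      rwa [ofIdx_smul_index, mul_inv_cancel_right] at h2
  rw [eq_top_iff]
  rintro ⟨g, hg⟩ -
  induction hg using weylGroup.induction with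
  | mem i => exact key i
  | one => exact one_mem _
  | mul x y hx hy ihx ihy => exact mul_mem ihx ihy

theorem smul_eq_of_dominant {g : P.weylGroup} {v : X} (hv : ∀ i ∈ b.support, 0 ≤ P.coroot' i v)
    (hgv : ∀ i ∈ b.support, 0 ≤ P.coroot' i (g • v)) :
    g • v = v ∧ g ∈ finiteParabolic P {i | i ∈ b.support ∧ P.coroot' i v = 0} := by
  have hg : g ∈ finiteParabolic P (b.support : Set ι) := by
    rw [finiteParabolic_support]; exact Subgroup.mem_top g
  obtain ⟨l, hl, rfl⟩ := exists_reflectionProd_eq hg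
  exact reflectionProd_smul_eq_of_dominant _ l rfl hl hv hgv

theorem mem_finiteParabolic_of_smul_faceVector {J : Set ι} {g : P.weylGroup}
    (hg : g • faceVector b J = faceVector b J) : g ∈ finiteParabolic P J := by
  have hv := fun i (hi : i ∈ b.support) => coroot'_faceVector_nonneg b J hi
  refine finiteParabolic_mono ?_ (smul_eq_of_dominant hv (by rwa [hg])).2
  rintro i ⟨hi, h0⟩
  by_contra hJ
  exact (coroot'_faceVector_pos b hi hJ).ne' h0

theorem finite_weylGroup (b : P.Base) : Finite P.weylGroup := by
  -- An element fixing every index keeps the regular vector dominant, hence fixes it, hence lies in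
  -- `W_∅ = 1`.
  refine Finite.of_injective (fun g : P.weylGroup => fun i : ι => g • i) fun g h hgh => ?_
  have hfix (i : ι) : (h⁻¹ * g) • i = i := by
    rw [mul_smul, inv_smul_eq_iff]; exact congrFun hgh i
  have hv := fun i (hi : i ∈ b.support) => coroot'_faceVector_nonneg b ∅ hi
  have hmem := (smul_eq_of_dominant (g := h⁻¹ * g) hv fun i hi => by
    rw [← hfix i, coroot'_smul_smul]; exact hv i hi).1
  have := mem_finiteParabolic_of_smul_faceVector hmem
  rw [finiteParabolic, Set.image_empty, Subgroup.closure_empty, Subgroup.mem_bot,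
    inv_mul_eq_one] at this
  exact this.symm

theorem exists_smul_dominant (b : P.Base) {J : Set ι} (hJ : J ⊆ b.support) (v : X) :
    ∃ u ∈ finiteParabolic P J, ∀ j ∈ J, 0 ≤ P.coroot' j (u • v) := by
  have := finite_weylGroup b
  -- Maximize over the orbit the pairing with a strictly dominant covector, a face vector of the
  -- dual datum; reflecting in a violated wall would increase it.
  obtain ⟨u, hu⟩ := Finite.exists_max fun u : finiteParabolic P J =>
    P.toLinearMap ((u : P.weylGroup) • v) (faceVector b.flip ∅)
  refine ⟨u, u.2, fun j hj => ?_⟩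
  have h1 := hu (⟨weylGroup.ofIdx P j, ofIdx_mem_finiteParabolic hj⟩ * u)
  have h2 : 0 < P.toLinearMap (P.root j) (faceVector b.flip ∅) :=
    coroot'_faceVector_pos b.flip (hJ hj) (Set.notMem_empty j)
  simp only [Subgroup.coe_mul, mul_smul] at h1
  rw [ofIdx_smul_eq (P := P) j ((u : P.weylGroup) • v), map_sub, map_zsmul, LinearMap.sub_apply,
    LinearMap.smul_apply, smul_eq_mul] at h1
  by_contra! h
  have := mul_neg_of_neg_of_pos h h2
  omega

end

end ExtAffineWeyl

/-! ### Elliptic elements of finite parabolic subgroups -/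

namespace ExtAffineWeyl

open RootPairing

section

variable {ι X Y : Type*} [AddCommGroup X] [AddCommGroup Y] {P : RootDatum ι X Y}

/-- An element of `W_J` that is not `W_J`-conjugate into `W_K` for any proper subset `K` of `J`. -/
structure IsEllipticIn (J : Set ι) (x : P.weylGroup) : Prop where
  mem : x ∈ finiteParabolic P J
  conj_notMem : ∀ u ∈ finiteParabolic P J, ∀ K : Set ι, K ⊂ J → u * x * u⁻¹ ∉ finiteParabolic P K

theorem conj_mem_finiteParabolic {J K : Set ι} {z : P.weylGroup} (hz : ∀ j ∈ J, z • j ∈ K)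
    {x : P.weylGroup} (hx : x ∈ finiteParabolic P J) : z * x * z⁻¹ ∈ finiteParabolic P K := by
  have h : finiteParabolic P J ≤ (finiteParabolic P K).comap (MulAut.conj z).toMonoidHom := by
    rw [finiteParabolic, Subgroup.closure_le]
    rintro _ ⟨j, hj, rfl⟩
    change z * weylGroup.ofIdx P j * z⁻¹ ∈ finiteParabolic P K
    rw [← ofIdx_smul_index]
    exact ofIdx_mem_finiteParabolic (hz j hj)
  exact h hx

variable [Finite ι] {b : P.Base}

/-- Move `v` by `u ∈ W_J` to be dominant along `J`, then add a large multiple of the `W_J`-invariant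
vector `faceVector b J` to make it dominant everywhere. The stabilizer of the sum is some `W_K` with
`K ⊆ J` and contains `u x u⁻¹`, so ellipticity forces `K = J`. -/
theorem IsEllipticIn.coroot'_eq_zero {J : Set ι} (hJ : J ⊆ b.support) {x : P.weylGroup}
    (hx : IsEllipticIn J x) {v : X} (hv : x • v = v) : ∀ j ∈ J, P.coroot' j v = 0 := by
  obtain ⟨u, hu, hdom⟩ := exists_smul_dominant b hJ v
  obtain ⟨N, hN⟩ : ∃ N : ℤ, ∀ i, -P.coroot' i (u • v) < N := by
    obtain ⟨N, hN⟩ := (Set.finite_range fun i => -P.coroot' i (u • v)).bddAbove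
    exact ⟨N + 1, fun i => Int.lt_add_one_of_le (hN ⟨i, rfl⟩)⟩
  have hN' : ∀ i ∈ b.support, i ∉ J →
      0 < P.coroot' i (u • v + (|N| : ℤ) • faceVector b J) := by
    intro i hi hiJ
    rw [map_add, map_zsmul, smul_eq_mul]
    have h1 := coroot'_faceVector_pos b hi hiJ
    have h2 := hN i
    have h3 := le_abs_self N
    nlinarith [abs_nonneg N]
  have hJ' : ∀ i ∈ J, P.coroot' i (u • v + (|N| : ℤ) • faceVector b J) =
      P.coroot' i (u • v) := by
    intro i hi
    rw [map_add, map_zsmul, coroot'_faceVector_eq_zero b (hJ hi) hi, smul_zero, add_zero]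
  have hdom' : ∀ i ∈ b.support, 0 ≤ P.coroot' i (u • v + (|N| : ℤ) • faceVector b J) := by
    intro i hi
    by_cases hiJ : i ∈ J
    · rw [hJ' i hiJ]; exact hdom i hiJ
    · exact (hN' i hi hiJ).le
  have hface {g : P.weylGroup} (hg : g ∈ finiteParabolic P J) :
      g • faceVector b J = faceVector b J :=
    smul_eq_of_mem_finiteParabolic (fun j hj => coroot'_faceVector_eq_zero b (hJ hj) hj) hg
  have hfix : (u * x * u⁻¹) • (u • v + (|N| : ℤ) • faceVector b J) =
      u • v + (|N| : ℤ) • faceVector b J := by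
    have h1 : (u * x * u⁻¹) • u • v = u • v := by
      rw [← mul_smul, inv_mul_cancel_right, mul_smul, hv]
    rw [smul_add, h1, smul_comm _ (|N| : ℤ), hface (mul_mem (mul_mem hu hx.mem) (inv_mem hu))]
  have hmem := (smul_eq_of_dominant hdom' (by rwa [hfix])).2
  set K : Set ι := {i | i ∈ b.support ∧
    P.coroot' i (u • v + (|N| : ℤ) • faceVector b J) = 0} with hK
  have hKJ : K ⊆ J := by
    rintro i ⟨hi, h0⟩
    by_contra hiJ
    exact (hN' i hi hiJ).ne' h0
  have hJK : J ⊆ K := by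
    by_contra h
    exact hx.conj_notMem u hu K ⟨hKJ, h⟩ hmem
  have hu0 : ∀ j ∈ J, P.coroot' j (u • v) = 0 := fun j hj => by
    rw [← hJ' j hj]; exact (hJK hj).2
  have huv : u⁻¹ • u • v = u • v := smul_eq_of_mem_finiteParabolic hu0 (inv_mem hu)
  rw [inv_smul_smul] at huv
  rwa [← huv] at hu0

/-- Indecomposability of simple coroots: a sum of positive coroots equal to the simple coroot `i`
must involve `i` itself, as `faceVector b {i}` is positive on every other positive coroot. -/
theorem exists_smul_index_eq {J : Set ι} {z : P.weylGroup} {m i : ι} (hi : i ∈ b.support)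
    (hmi : z • m = i) (hm : P.coroot m ∈ AddSubmonoid.closure (P.coroot '' J))
    (hz : ∀ j ∈ J, IsPosCoroot b (z • j)) : ∃ j ∈ J, z • j = i := by
  by_contra! h
  have h1 : 0 < P.coroot' m (z⁻¹ • faceVector b {i}) := by
    refine toLinearMap_pos_of_mem_closure (fun j hj => ?_) hm (P.ne_zero' m)
    rw [← coroot'_smul]
    exact (hz j hj).faceVector_singleton_pos hi (h j hj)
  rw [← coroot'_smul, hmi, coroot'_faceVector_eq_zero b hi (Set.mem_singleton i)] at h1
  exact lt_irrefl _ h1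

theorem exists_smul_index_image_eq (b : P.Base) {J K : Set ι} (hJ : J ⊆ b.support)
    (hK : K ⊆ b.support)
    {x y : P.weylGroup} (hx : IsEllipticIn J x) (hy : IsEllipticIn K (y * x * y⁻¹)) :
    ∃ u ∈ finiteParabolic P K, (∀ j ∈ J, (u * y) • j ∈ K) ∧ ∀ k ∈ K, (u * y)⁻¹ • k ∈ J := by
  have hface {L : Set ι} (hL : L ⊆ b.support) {g : P.weylGroup} (hg : g ∈ finiteParabolic P L) :
      g • faceVector b L = faceVector b L :=
    smul_eq_of_mem_finiteParabolic (fun j hj => coroot'_faceVector_eq_zero b (hL hj) hj) hg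
  have hJ0 : ∀ j ∈ J, P.coroot' j (y⁻¹ • faceVector b K) = 0 := by
    apply hx.coroot'_eq_zero hJ
    rw [eq_inv_smul_iff, ← mul_smul, ← mul_smul, hface hK hy.mem]
  have hK0 : ∀ k ∈ K, P.coroot' k (y • faceVector b J) = 0 := by
    apply hy.coroot'_eq_zero hK
    rw [← mul_smul, inv_mul_cancel_right, mul_smul, hface hJ hx.mem]
  -- This `u` aligns the positive systems: `(u y)⁻¹` sends `K` to positive coroots. Being in `W_K`,
  -- it preserves the vanishing in `hJ0` and `hK0`.
  obtain ⟨u, hu, hdom⟩ := exists_smul_dominant b hK (y • faceVector b ∅)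
  have hposK : ∀ k ∈ K, IsPosCoroot b ((u * y)⁻¹ • k) := by
    intro k hk
    apply IsPosCoroot.of_faceVector_nonneg
    rw [coroot'_smul, inv_inv, mul_smul]
    exact hdom k hk
  have hclJ : ∀ k ∈ K, P.coroot ((u * y)⁻¹ • k) ∈ AddSubmonoid.closure (P.coroot '' J) := by
    intro k hk
    refine mem_closure_of_faceVector_eq_zero (hposK k hk) ?_
    change P.coroot' ((u * y)⁻¹ • k) (faceVector b J) = 0
    rw [coroot'_smul, inv_inv, mul_smul, smul_eq_of_mem_finiteParabolic hK0 hu]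
    exact hK0 k hk
  have hface0 : ∀ j ∈ J, P.coroot' ((u * y) • j) (faceVector b K) = 0 := by
    intro j hj
    rw [coroot'_smul, mul_inv_rev, mul_smul, hface hK (inv_mem hu)]
    exact hJ0 j hj
  have hposJ : ∀ j ∈ J, IsPosCoroot b ((u * y) • j) := by
    intro j hj
    by_contra h
    have hm := mem_closure_of_faceVector_eq_zero (J := K)
      ((b.coroot_mem_or_neg_mem ((u * y) • j)).resolve_left h) (by
        rw [map_neg, neg_eq_zero]; exact hface0 j hj)
    have h1 : 0 ≤ P.toLinearMap ((u * y) • faceVector b ∅) (-P.coroot ((u * y) • j)) :=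
      toLinearMap_nonneg_of_mem_closure (fun k hk => by rw [mul_smul]; exact hdom k hk) hm
    have h2 : P.toLinearMap ((u * y) • faceVector b ∅) (P.coroot ((u * y) • j)) =
      P.coroot' j (faceVector b ∅) := coroot'_smul_smul _ _ _
    rw [map_neg, h2] at h1
    have := coroot'_faceVector_pos b (hJ hj) (Set.notMem_empty j)
    omega
  refine ⟨u, hu, fun j hj => ?_, fun k hk => ?_⟩
  · obtain ⟨k, hk, hkj⟩ := exists_smul_index_eq (hJ hj) (inv_smul_smul (u * y) j)
      (mem_closure_of_faceVector_eq_zero (hposJ j hj) (hface0 j hj)) hposK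
    rwa [← hkj, smul_inv_smul]
  · obtain ⟨j, hj, hjk⟩ := exists_smul_index_eq (hK hk) (smul_inv_smul (u * y) k)
      (hclJ k hk) hposJ
    rwa [← hjk, inv_smul_smul]

end

/-! ### Newton points, classes of the extended group and the bijection -/

section

variable {ι X Y : Type*} [AddCommGroup X] [AddCommGroup Y] {P : RootDatum ι X Y}

theorem conj_translation (g : ExtWeyl P) (l : X) :
    g * translation P l * g⁻¹ = translation P (g.right • l) := by
  apply SemidirectProduct.ext
  · simp only [translation, SemidirectProduct.mul_left, SemidirectProduct.left_inl,
      SemidirectProduct.mul_right, SemidirectProduct.right_inl, mul_one,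
      SemidirectProduct.inv_left, map_inv, weylAction_apply, ← MulAut.mul_apply, mul_inv_cancel,
      MulAut.one_apply]
    rw [mul_right_comm, mul_inv_cancel, one_mul]
  · simp [translation]

theorem powTranslation_conj (g w : ExtWeyl P) :
    powTranslation (g * w * g⁻¹) = g.right • powTranslation w := by
  have h := pow_card_eq_translation (g * w * g⁻¹)
  rw [conj_pow, pow_card_eq_translation, conj_translation] at h
  exact (Multiplicative.ofAdd.injective (SemidirectProduct.inl_injective h)).symm

theorem right_smul_powTranslation (w : ExtWeyl P) :
    w.right • powTranslation w = powTranslation w := by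
  rw [← powTranslation_conj, mul_inv_cancel_right]

theorem isDominant_newtonPoint_iff [Finite ι] (b : P.Base) (w : ExtWeyl P) :
    IsDominant b (newtonPoint w) ↔ ∀ i ∈ b.support, 0 ≤ P.coroot' i (powTranslation w) := by
  have := finite_weylGroup b
  have hpos : (0 : ℚ) < (Nat.card P.weylGroup : ℚ)⁻¹ :=
    inv_pos.2 (Nat.cast_pos.2 Nat.card_pos)
  refine forall₂_congr fun i _ => ?_
  rw [newtonPoint, corootPairing_tmul, mul_nonneg_iff_of_pos_right hpos, Int.cast_nonneg_iff]
  rfl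

theorem mem_parabolic {J : Set ι} {w : ExtWeyl P} :
    w ∈ parabolic P J ↔ w.right ∈ finiteParabolic P J := Iff.rfl

theorem classSet_subset {J : Set ι} (C : ConjClasses (parabolic P J)) :
    classSet C ⊆ parabolic P J := by
  rintro _ ⟨v, -, rfl⟩
  exact v.2

theorem conj_mem_classSet {J : Set ι} {C : ConjClasses (parabolic P J)} {w g : ExtWeyl P}
    (hw : w ∈ classSet C) (hg : g ∈ parabolic P J) : g * w * g⁻¹ ∈ classSet C := by
  obtain ⟨v, hv, rfl⟩ := hw
  refine ⟨⟨g, hg⟩ * v * ⟨g, hg⟩⁻¹, ?_, rfl⟩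
  rw [ConjClasses.mem_carrier_iff_mk_eq] at hv ⊢
  rw [← hv, ConjClasses.mk_eq_mk_iff_isConj, isConj_comm]
  exact isConj_iff.2 ⟨⟨g, hg⟩, rfl⟩

theorem exists_conj_of_mem_classSet {J : Set ι} {C : ConjClasses (parabolic P J)}
    {v w : ExtWeyl P} (hv : v ∈ classSet C) (hw : w ∈ classSet C) :
    ∃ g ∈ parabolic P J, g * v * g⁻¹ = w := by
  obtain ⟨v, hv, rfl⟩ := hv
  obtain ⟨w, hw, rfl⟩ := hw
  rw [ConjClasses.mem_carrier_iff_mk_eq] at hv hw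
  obtain ⟨g, hg⟩ := isConj_iff.1 (ConjClasses.mk_eq_mk_iff_isConj.1 (hv.trans hw.symm))
  exact ⟨g, g.2, congrArg Subtype.val hg⟩

theorem classSet_nonempty {J : Set ι} (C : ConjClasses (parabolic P J)) : (classSet C).Nonempty := by
  obtain ⟨v, hv⟩ := ConjClasses.exists_rep C
  exact ⟨v, v, ConjClasses.mem_carrier_iff_mk_eq.2 hv, rfl⟩

theorem IsElliptic.isEllipticIn {J : Set ι} {C : ConjClasses (parabolic P J)} (hC : IsElliptic C)
    {w : ExtWeyl P} (hw : w ∈ classSet C) : IsEllipticIn J w.right where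
  mem := classSet_subset C hw
  conj_notMem u hu K hK h :=
    Set.disjoint_left.1 (hC K hK)
      (conj_mem_classSet (g := SemidirectProduct.inr u) hw (by rwa [mem_parabolic]))
      (by simpa [mem_parabolic] using h)

variable [Finite ι] {b : P.Base}

theorem EllipticPair.rel_of_toConjClass_eq (p q : EllipticPair b)
    (h : p.toConjClass = q.toConjClass) : EllipticPair.Rel p q := by
  obtain ⟨v, hv⟩ := classSet_nonempty p.C
  obtain ⟨w, hw⟩ := classSet_nonempty q.C
  rw [p.toConjClass_eq hv, q.toConjClass_eq hw, ConjClasses.mk_eq_mk_iff_isConj] at h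
  obtain ⟨g, rfl⟩ := isConj_iff.1 h
  obtain ⟨u, hu, hJ, hK⟩ := exists_smul_index_image_eq b p.subset_simple q.subset_simple
    (p.elliptic.isEllipticIn hv) (y := g.right) (by simpa using q.elliptic.isEllipticIn hw)
  set z := u * g.right with hz
  have hconjJ {x : ExtWeyl P} (hx : x ∈ parabolic P p.J) :
      SemidirectProduct.inr z * x * (SemidirectProduct.inr z)⁻¹ ∈ parabolic P q.J := by
    simpa [mem_parabolic] using conj_mem_finiteParabolic hJ (mem_parabolic.1 hx)
  have hconjK {x : ExtWeyl P} (hx : x ∈ parabolic P q.J) :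
      (SemidirectProduct.inr z)⁻¹ * x * SemidirectProduct.inr z ∈ parabolic P p.J := by
    simpa [mem_parabolic] using conj_mem_finiteParabolic hK (mem_parabolic.1 hx)
  -- The finite part of this element is `u`. Hence conjugation by `z` and by `g` differ by an inner
  -- automorphism of `X ⋊ W_{q.J}`, which preserves the class `q.C`.
  have hk : SemidirectProduct.inr z * g⁻¹ ∈ parabolic P q.J := by
    simpa [mem_parabolic, hz] using hu
  refine ⟨z, ?_, ?_⟩
  · rw [Set.image_image]
    ext m
    constructor
    · rintro ⟨j, hj, rfl⟩
      exact ⟨z • j, hJ j hj, root_smul z j⟩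
    · rintro ⟨k, hk, rfl⟩
      exact ⟨z⁻¹ • k, hK k hk, by
        beta_reduce
        rw [← root_smul, smul_inv_smul]⟩
  · ext m
    constructor
    · rintro ⟨x, hx, rfl⟩
      obtain ⟨a, ha, rfl⟩ := exists_conj_of_mem_classSet hv hx
      have := conj_mem_classSet hw (mul_mem (hconjJ ha) hk)
      convert this using 1
      group
    · intro hm
      obtain ⟨a, ha, rfl⟩ := exists_conj_of_mem_classSet hw hm
      have := conj_mem_classSet hv (hconjK (mul_mem ha (inv_mem hk)))
      refine ⟨_, this, ?_⟩
      group

theorem exists_ellipticPair_toConjClass_eq (b : P.Base) (w : ExtWeyl P) :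
    ∃ p : EllipticPair b, p.toConjClass = ConjClasses.mk w := by
  obtain ⟨u, -, hu⟩ := exists_smul_dominant b (subset_refl _) (powTranslation w)
  set v : ExtWeyl P := SemidirectProduct.inr u * w * (SemidirectProduct.inr u)⁻¹ with hv
  have hvw : ConjClasses.mk v = ConjClasses.mk w := by
    rw [ConjClasses.mk_eq_mk_iff_isConj, isConj_comm]
    exact isConj_iff.2 ⟨_, rfl⟩
  have hdom : ∀ i ∈ b.support, 0 ≤ P.coroot' i (powTranslation v) := by
    rw [hv, powTranslation_conj]; exact hu
  set J₀ : Set ι := {i | i ∈ b.support ∧ P.coroot' i (powTranslation v) = 0}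
  have hfix {g : P.weylGroup} (hg : g ∈ finiteParabolic P J₀) :
      g • powTranslation v = powTranslation v :=
    smul_eq_of_mem_finiteParabolic (fun j hj => hj.2) hg
  have hv0 : v.right ∈ finiteParabolic P J₀ :=
    (smul_eq_of_dominant hdom (by rwa [right_smul_powTranslation])).2
  -- Conjugators range over `W_{J₀}` rather than `W_J`: they still fix the translation part, and
  -- minimality then covers every element of `C`.
  obtain ⟨J, ⟨hJ, a, ha, haJ⟩, hmin⟩ := exists_minimal_of_wellFoundedLT
    (fun J : Set ι => J ⊆ J₀ ∧ ∃ a ∈ finiteParabolic P J₀, a * v.right * a⁻¹ ∈ finiteParabolic P J)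
    ⟨J₀, subset_refl _, 1, one_mem _, by simpa using hv0⟩
  set x : ExtWeyl P := SemidirectProduct.inr a * v * (SemidirectProduct.inr a)⁻¹ with hx
  have hxJ : x ∈ parabolic P J := by simpa [mem_parabolic, hx] using haJ
  obtain ⟨C, hxC⟩ : ∃ C : ConjClasses (parabolic P J), x ∈ classSet C :=
    ⟨ConjClasses.mk ⟨x, hxJ⟩, ⟨x, hxJ⟩, ConjClasses.mem_carrier_mk, rfl⟩
  have hC {y : ExtWeyl P} (hy : y ∈ classSet C) : ∃ g : ExtWeyl P,
      g.right ∈ finiteParabolic P J₀ ∧ y = g * v * g⁻¹ := by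
    obtain ⟨c, hc, rfl⟩ := exists_conj_of_mem_classSet hxC hy
    refine ⟨c * SemidirectProduct.inr a, ?_, by rw [hx]; group⟩
    simpa using mul_mem (finiteParabolic_mono hJ (mem_parabolic.1 hc)) ha
  have hell : IsElliptic C := by
    intro K hK
    rw [Set.disjoint_left]
    intro y hy hyK
    obtain ⟨g, hg, rfl⟩ := hC hy
    have hgK : g.right * v.right * g.right⁻¹ ∈ finiteParabolic P K := by
      have h := mem_parabolic.1 hyK
      rwa [SemidirectProduct.mul_right, SemidirectProduct.mul_right,
        SemidirectProduct.inv_right] at h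
    exact hK.2 (hmin ⟨hK.1.trans hJ, g.right, hg, hgK⟩ hK.1)
  have hCdom : ∀ y ∈ classSet C, IsDominant b (newtonPoint y) := by
    intro y hy
    obtain ⟨g, hg, rfl⟩ := hC hy
    rw [isDominant_newtonPoint_iff, powTranslation_conj, hfix hg]
    exact hdom
  let p : EllipticPair b := ⟨J, fun i hi => (hJ hi).1, C, hell, hCdom⟩
  have hp : x ∈ classSet p.C := hxC
  refine ⟨p, (p.toConjClass_eq hp).trans ?_⟩
  rw [← hvw, ConjClasses.mk_eq_mk_iff_isConj, isConj_comm]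
  exact isConj_iff.2 ⟨_, rfl⟩

end

end ExtAffineWeyl

theorem mainTheorem8 {ι X Y : Type*} [Finite ι] [AddCommGroup X] [AddCommGroup Y]
    [Module.Finite ℤ X] [Module.Finite ℤ Y] (P : RootDatum ι X Y) (b : P.Base) :
    Function.Bijective (ExtAffineWeyl.pairClassMap b) := by
  constructor
  · intro p q
    induction p using Quotient.inductionOn
    induction q using Quotient.inductionOn
    exact fun h => Quotient.sound (ExtAffineWeyl.EllipticPair.rel_of_toConjClass_eq _ _ h)
  · intro c
    obtain ⟨w, rfl⟩ := ConjClasses.exists_rep c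
    obtain ⟨p, hp⟩ := ExtAffineWeyl.exists_ellipticPair_toConjClass_eq b w
    exact ⟨Quotient.mk _ p, hp⟩
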